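/- **Proposition 4.** *Setting.* Consider a memoryless two-user multiple access channel (MAC) $(\mathcal X_1\times\mathcal X_2,\,p(y|x_1,x_2),\,\mathcal Y)$. It is either discrete ($\mathcal X_1,\mathcal X_2,\mathcal Y$ countable and $p(\cdot|x_1,x_2)$ a probability mass function) or continuous ($\mathcal X_1=\mathcal X_2=\mathcal Y=\mathbb R$ and $p(\cdot|x_1,x_2)$ a probability density); more generally, $p(\cdot|x_1,x_2)$ may be a probability density with respect to any fixed $\sigma$-finite measure $\nu$ on $\mathcal Y$. Its $n$-th extension is $p(y^n|x_1^n,x_2^n)=\prod_{t=1}^n p(y_t|x_{1t},x_{2t})$. Let $\mathbf C_{\mathrm{in}}=(C^1_{\mathrm{in}},C^2_{\mathrm{in}})$ and $\mathbf C_{\mathrm{out}}=(C^1_{\mathrm{out}},C^2_{\mathrm{out}})$ be in $\mathbb R_{\ge 0}^2$. An $(n,M_1,M_2,J)$-code for the MAC with a $(\mathbf C_{\mathrm{in}},\mathbf C_{\mathrm{out}})$-cooperation facilitator (CF) consists of finite alphabets $\mathcal U_{ij},\mathcal V_{ij}$ ($i\in\{1,2\}$, $1\le j\le J$) with $\sum_j\log_2|\mathcal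 U_{ij}|\le nC^i_{\mathrm{in}}$ and $\sum_j\log_2|\mathcal V_{ij}|\le nC^i_{\mathrm{out}}$, and of functions $$\varphi_{ij}:[M_i]\times\prod_{\ell<j}\mathcal V_{i\ell}\to\mathcal U_{ij},\qquad \psi_{ij}:\prod_{\ell\le j}\mathcal U_{1\ell}\times\prod_{\ell\le j}\mathcal U_{2\ell}\to\mathcal V_{ij},\qquad f_i:[M_i]\times\prod_{j\le J}\mathcal V_{ij}\to\mathcal X_i^n,\qquad g:\mathcal Y^n\to[M_1]\times[M_2].$$ On messages $(m_1,m_2)$, encoder $i$ sends $u_{ij}=\varphi_{ij}(m_i,v_{i1},\dots,v_{i,j-1})$ to the CF in round $j$, the CF answers $v_{ij}=\psi_{ij}((u_{1\ell})_{\ell\le j},(u_{2\ell})_{\ell\le j})$, and after round $J$ encoder $i$ transmits $f_i(m_i,v_{i1},\dots,v_{iJ})$ over the channel. Let $\lambda_n(m_1,m_2)$ be the probability that the output $y^n$ satisfies $g(y^n)\neq(m_1,m_2)$. The average (maximal) error of the code is the average (maximum) of $\lambda_n$ over all message pairs. A pair $(R_1,R_2)\in\mathbb R_{\ge0}^2$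 is achievable with $J$ rounds under average (maximal) error if for all $\epsilon,\delta>0$ and all sufficiently large $n$ there is an $(n,M_1,M_2,J)$-code with $\frac1n\log_2M_i\ge R_i-\delta$ for $i\in\{1,2\}$ and average (maximal) error at most $\epsilon$. Let $\mathscr C^J_{\mathrm{avg}}$ ($\mathscr C^J_{\mathrm{max}}$) be the closure of the set of such pairs, let $\mathscr C_{\mathrm{avg}}(\mathbf C_{\mathrm{in}},\mathbf C_{\mathrm{out}})=\overline{\bigcup_{J\ge1}\mathscr C^J_{\mathrm{avg}}(\mathbf C_{\mathrm{in}},\mathbf C_{\mathrm{out}})}$, and define $\mathscr C_{\mathrm{max}}(\mathbf C_{\mathrm{in}},\mathbf C_{\mathrm{out}})$ similarly. For $\alpha\in[0,1]$ put $$C^\alpha_{\mathrm{avg}}(\mathbf C_{\mathrm{in}},\mathbf C_{\mathrm{out}})=\sup_{(x,y)\in\mathscr C_{\mathrm{avg}}(\mathbf C_{\mathrm{in}},\mathbf C_{\mathrm{out}})}\big(\alpha x+(1-\alpha)y\big),\qquad C^\alpha_{\mathrm{max}}(\mathbf C_{\mathrm{in}},\mathbf C_{\mathrm{out}})=\sup_{(x,y)\in\mathscr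 C_{\mathrm{max}}(\mathbf C_{\mathrm{in}},\mathbf C_{\mathrm{out}})}\big(\alpha x+(1-\alpha)y\big),$$ with values in the extended reals. (The suprema are maxima whenever the regions are nonempty and bounded.) *Statement.* Fix $\alpha\in(0,1)$ and $\mathbf C_{\mathrm{in}}\in\mathbb R_{>0}^2$. For every MAC with $$C^\alpha_{\mathrm{avg}}(\mathbf 0,\mathbf 0)>C^\alpha_{\mathrm{max}}(\mathbf 0,\mathbf 0),$$ the function $\mathbf C_{\mathrm{out}}\mapsto C^\alpha_{\mathrm{max}}(\mathbf C_{\mathrm{in}},\mathbf C_{\mathrm{out}})$ on $\mathbb R_{\ge0}^2$ is not continuous at $\mathbf C_{\mathrm{out}}=\mathbf 0$. -/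

import Mathlib

open scoped NNReal ENNReal

universe u v

/-- A memoryless two-user multiple access channel `(𝒳₁ × 𝒳₂, p(y|x₁,x₂), 𝒴)`. The two encoders are
indexed by `i : Fin 2`. For every input pair `x`, `p x` is a probability density on the
output alphabet with respect to a σ-finite reference measure `ν`: counting measure for a discrete
channel (`p x` is then a probability mass function, see `MAC.discrete`), Lebesgue measure on `ℝ`
for a continuous one (see `MAC.continuous`). -/
structure MAC (X : Fin 2 → Type u) (Y : Type v) [MeasurableSpace Y] where
  /-- the reference measure on the output alphabet -/
  ν : MeasureTheory.Measure Y
  sigmaFinite : MeasureTheory.SigmaFinite ν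
  /-- the channel law `p(y|x₁,x₂)` -/
  p : (∀ i, X i) → Y → ℝ≥0
  measurable_p : ∀ x, Measurable (p x)
  lintegral_p : ∀ x, ∫⁻ y, (p x y : ℝ≥0∞) ∂ν = 1

/-- The discrete channel given by a probability mass function on a countable output alphabet
for each input pair. -/
noncomputable def MAC.discrete {X : Fin 2 → Type u} {Y : Type v} [Countable Y]
    (p : (∀ i, X i) → Y → ℝ≥0) (hp : ∀ x, HasSum (p x) 1) : @MAC X Y ⊤ :=
  letI : MeasurableSpace Y := ⊤
  { ν := MeasureTheory.Measure.count
    sigmaFinite := inferInstance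
    p := p
    measurable_p := fun _ => measurable_from_top
    lintegral_p := fun x => by
      rw [MeasureTheory.lintegral_count]
      exact (ENNReal.hasSum_coe.2 (hp x)).tsum_eq }

/-- The continuous channel given by a probability density function on `ℝ` for each pair of
real inputs. -/
noncomputable def MAC.continuous (p : (Fin 2 → ℝ) → ℝ → ℝ≥0) (hm : ∀ x, Measurable (p x))
    (hp : ∀ x, ∫⁻ y, (p x y : ℝ≥0∞) = 1) : MAC (fun _ => ℝ) ℝ where
  ν := MeasureTheory.volume
  sigmaFinite := inferInstance
  p := p
  measurable_p := hm
  lintegral_p := hp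

/-- An `(n, M₁, M₂, J)`-code with a cooperation facilitator (CF). In round `j`, encoder `i` sends
to the CF a symbol of an alphabet with `uCard i j` elements, and the CF answers encoder `i`
with a symbol of an alphabet with `vCard i j` elements. -/
structure CFCode (X : Fin 2 → Type u) (Y : Type v) [MeasurableSpace Y]
    (n : ℕ) (M : Fin 2 → ℕ) (J : ℕ) where
  /-- sizes of the alphabets `𝒰ᵢⱼ` -/
  uCard : Fin 2 → Fin J → ℕ
  /-- sizes of the alphabets `𝒱ᵢⱼ` -/
  vCard : Fin 2 → Fin J → ℕ
  /-- `φᵢⱼ : [Mᵢ] × 𝒱ᵢʲ⁻¹ → 𝒰ᵢⱼ`: what encoder `i` sends to the CF in round `j`, from its own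
  message and the CF's answers in the rounds before `j` -/
  φ : ∀ (i : Fin 2) (j : Fin J), Fin (M i) → (∀ l, l < j → Fin (vCard i l)) → Fin (uCard i j)
  /-- `ψᵢⱼ : 𝒰₁ʲ × 𝒰₂ʲ → 𝒱ᵢⱼ`: what the CF sends to encoder `i` in round `j`, from all that both
  encoders sent up to and including round `j` -/
  ψ : ∀ (i : Fin 2) (j : Fin J), (∀ k l, l ≤ j → Fin (uCard k l)) → Fin (vCard i j)
  /-- `fᵢ : [Mᵢ] × 𝒱ᵢᴶ → 𝒳ᵢⁿ`: the codeword of encoder `i` -/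
  f : ∀ i : Fin 2, Fin (M i) → (∀ j, Fin (vCard i j)) → Fin n → X i
  /-- the decoder `g : 𝒴ⁿ → [M₁] × [M₂]` -/
  g : (Fin n → Y) → ∀ i, Fin (M i)
  measurable_g : Measurable g

namespace CFCode

variable {X : Fin 2 → Type u} {Y : Type v} [MeasurableSpace Y] {n : ℕ} {M : Fin 2 → ℕ} {J : ℕ}

/-- The symbol `vᵢⱼ` that the CF sends to encoder `i` in round `j` on message pair `m`. -/
def cfSymbol (c : CFCode X Y n M J) (m : ∀ i, Fin (M i)) (i : Fin 2) (j : Fin J) :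
    Fin (c.vCard i j) :=
  c.ψ i j fun k l _ => c.φ k l (m k) fun l' _ => c.cfSymbol m k l'
termination_by j.val
decreasing_by exact lt_of_lt_of_le (by assumption : l' < l) (by assumption : l ≤ j)

/-- The symbol `uᵢⱼ` that encoder `i` sends to the CF in round `j` on message pair `m`. -/
def encSymbol (c : CFCode X Y n M J) (m : ∀ i, Fin (M i)) (i : Fin 2) (j : Fin J) :
    Fin (c.uCard i j) :=
  c.φ i j (m i) fun l _ => c.cfSymbol m i l

theorem cfSymbol_eq (c : CFCode X Y n M J) (m : ∀ i, Fin (M i)) (i : Fin 2) (j : Fin J) :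
    c.cfSymbol m i j = c.ψ i j fun k l _ => c.encSymbol m k l := by
  rw [cfSymbol]; rfl

/-- The total rate constraints of a `(C_in, C_out)`-CF: over all rounds, at most `n C_inⁱ` bits
from encoder `i` to the CF and at most `n C_outⁱ` bits from the CF to encoder `i`. -/
def Respects (c : CFCode X Y n M J) (Cin Cout : Fin 2 → ℝ≥0) : Prop :=
  ∀ i, ∑ j, Real.logb 2 (c.uCard i j) ≤ n * Cin i ∧
    ∑ j, Real.logb 2 (c.vCard i j) ≤ n * Cout i

/-- The channel inputs at time `t` on message pair `m`. -/
def input (c : CFCode X Y n M J) (m : ∀ i, Fin (M i)) (t : Fin n) (i : Fin 2) : X i :=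
  c.f i (m i) (c.cfSymbol m i) t

/-- `λₙ(m₁,m₂)`: the probability, under the `n`-th memoryless extension of the channel, that the
message pair `m` is decoded incorrectly. -/
noncomputable def errorProb (c : CFCode X Y n M J) (W : MAC X Y) (m : ∀ i, Fin (M i)) : ℝ :=
  (∫⁻ y in {y : Fin n → Y | c.g y ≠ m}, ∏ t, (W.p (c.input m t) (y t) : ℝ≥0∞)
    ∂(MeasureTheory.Measure.pi fun _ => W.ν)).toReal

/-- The average probability of error. -/
noncomputable def avgError (c : CFCode X Y n M J) (W : MAC X Y) : ℝ :=
  (∑ m, c.errorProb W m) / (M 0 * M 1)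

/-- The maximal probability of error. -/
noncomputable def maxError (c : CFCode X Y n M J) (W : MAC X Y) : ℝ :=
  ⨆ m, c.errorProb W m

end CFCode

namespace MAC

variable {X : Fin 2 → Type u} {Y : Type v} [MeasurableSpace Y]

/-- Achievability under average error of the rate pair `R` with a `(C_in, C_out)`-CF and
`J` rounds of cooperation. -/
def AvgAchievable (W : MAC X Y) (Cin Cout : Fin 2 → ℝ≥0) (J : ℕ) (R : Fin 2 → ℝ) : Prop :=
  ∀ ε > (0 : ℝ), ∀ δ > (0 : ℝ), ∃ N : ℕ, ∀ n ≥ N,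
    ∃ (M : Fin 2 → ℕ) (c : CFCode X Y n M J), (∀ i, 1 ≤ M i) ∧ c.Respects Cin Cout ∧
      (∀ i, R i - δ ≤ 1 / n * Real.logb 2 (M i)) ∧ c.avgError W ≤ ε

/-- Achievability under maximal error of the rate pair `R` with a `(C_in, C_out)`-CF and
`J` rounds of cooperation. -/
def MaxAchievable (W : MAC X Y) (Cin Cout : Fin 2 → ℝ≥0) (J : ℕ) (R : Fin 2 → ℝ) : Prop :=
  ∀ ε > (0 : ℝ), ∀ δ > (0 : ℝ), ∃ N : ℕ, ∀ n ≥ N,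
    ∃ (M : Fin 2 → ℕ) (c : CFCode X Y n M J), (∀ i, 1 ≤ M i) ∧ c.Respects Cin Cout ∧
      (∀ i, R i - δ ≤ 1 / n * Real.logb 2 (M i)) ∧ c.maxError W ≤ ε

/-- The average-error capacity region with `J` rounds of cooperation. -/
def avgRegionRounds (W : MAC X Y) (Cin Cout : Fin 2 → ℝ≥0) (J : ℕ) : Set (Fin 2 → ℝ) :=
  closure {R | 0 ≤ R ∧ W.AvgAchievable Cin Cout J R}

/-- The maximal-error capacity region with `J` rounds of cooperation. -/
def maxRegionRounds (W : MAC X Y) (Cin Cout : Fin 2 → ℝ≥0) (J : ℕ) : Set (Fin 2 → ℝ) :=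
  closure {R | 0 ≤ R ∧ W.MaxAchievable Cin Cout J R}

/-- The average-error capacity region `𝒞_avg(C_in, C_out)`, over all numbers `J ≥ 1` of rounds. -/
def avgRegion (W : MAC X Y) (Cin Cout : Fin 2 → ℝ≥0) : Set (Fin 2 → ℝ) :=
  closure (⋃ J : ℕ, ⋃ _ : 1 ≤ J, W.avgRegionRounds Cin Cout J)

/-- The maximal-error capacity region `𝒞_max(C_in, C_out)`, over all numbers `J ≥ 1` of rounds. -/
def maxRegion (W : MAC X Y) (Cin Cout : Fin 2 → ℝ≥0) : Set (Fin 2 → ℝ) :=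
  closure (⋃ J : ℕ, ⋃ _ : 1 ≤ J, W.maxRegionRounds Cin Cout J)

end MAC

/-- `C^α(𝒞)`, the supremum of `α x + (1 - α) y` over `(x, y) ∈ 𝒞`. It is a maximum when `𝒞` is
compact and nonempty, and `⊤` when an unbounded region makes it infinite. -/
noncomputable def weightedSum (α : ℝ) (S : Set (Fin 2 → ℝ)) : EReal :=
  ⨆ R ∈ S, ((α * R 0 + (1 - α) * R 1 : ℝ) : EReal)

namespace MAC

variable {X : Fin 2 → Type u} {Y : Type v} [MeasurableSpace Y]

/-- `C^α_avg(C_in, C_out)`. -/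
noncomputable def avgSumCapacity (W : MAC X Y) (α : ℝ) (Cin Cout : Fin 2 → ℝ≥0) : EReal :=
  weightedSum α (W.avgRegion Cin Cout)

/-- `C^α_max(C_in, C_out)`. -/
noncomputable def maxSumCapacity (W : MAC X Y) (α : ℝ) (Cin Cout : Fin 2 → ℝ≥0) : EReal :=
  weightedSum α (W.maxRegion Cin Cout)

end MAC

/-! With zero output rate the facilitator's answers are constants, so the value at zero output is
the value μ without cooperation. It therefore suffices that every positive output rate to encoder
`0`, however small, lifts the maximal-error value to at least one fixed r > μ
(`exists_lt_le_maxSumCapacity`). Take R achievable under average error with weighted sum A > μ, and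
S achievable under maximal error with weighted sum near μ, both without cooperation. A fraction β of
the block, with β R_i below the input rates, uses a code for R whose messages the facilitator learns
in full; the rest uses a code for S (`maxAchievable_timeShare`). The average-error code becomes a
maximal-error one almost for free. In its matrix of error probabilities, keep columns of small mean
and form disjoint families of K rows, K about the logarithm of the number of columns kept, so that
each kept column has a small entry in every family (`exists_small_entries`). A new message of
encoder `0` is a family, and the facilitator, knowing both messages, names the row to send. Since K
grows at most linearly in the blocklength, the name costs O(log n) bits, which any positive output
rate eventually covers. -/

/-! ### Selecting rows and columns of a matrix with small mean -/

open Finset in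
/-- If every `c ∈ C` is good for at least half of the elements of `T`, then fewer than
`log₂ |C| + 1` elements of `T` suffice to have a good one for every `c ∈ C`. -/
theorem exists_hitting_family {ι κ : Type*} (good : ι → κ → Prop) (T : Finset ι)
    (hT : T.Nonempty) [∀ i c, Decidable (good i c)] (K : ℕ) (C : Finset κ) (hK : #C < 2 ^ K)
    (h : ∀ c ∈ C, #T ≤ 2 * #{i ∈ T | good i c}) :
    ∃ τ : Fin K → ι, (∀ k, τ k ∈ T) ∧ ∀ c ∈ C, ∃ k, good (τ k) c := by
  induction K generalizing C with
  | zero =>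
    have hC : C = ∅ := by simpa using hK
    subst hC
    exact ⟨Fin.elim0, fun k => k.elim0, by simp⟩
  | succ K ih =>
    have hcount : ∑ i ∈ T, #{c ∈ C | good i c} = ∑ c ∈ C, #{i ∈ T | good i c} :=
      sum_card_bipartiteAbove_eq_sum_card_bipartiteBelow good
    have hle : ∑ _i ∈ T, #C ≤ ∑ i ∈ T, 2 * #{c ∈ C | good i c} := by
      rw [← mul_sum, hcount, mul_sum, sum_const, smul_eq_mul, mul_comm]
      calc #C * #T = ∑ _c ∈ C, #T := by simp
        _ ≤ _ := sum_le_sum h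
    -- Double counting: some `i` is good for at least half of `C`. What it misses has fewer than `2
    -- ^ K` elements, and the induction goes on with it.
    obtain ⟨i, hi, hic⟩ := exists_le_of_sum_le hT hle
    have hsplit := card_filter_add_card_filter_not (s := C) (fun c => good i c)
    obtain ⟨τ, hτ, hgood⟩ := ih {c ∈ C | ¬ good i c} (by rw [pow_succ] at hK; omega)
      fun c hc => h c (mem_filter.1 hc).1
    refine ⟨Fin.cons i τ, Fin.cases hi hτ, fun c hc => ?_⟩
    by_cases hg : good i c
    · exact ⟨0, hg⟩
    · obtain ⟨k, hk⟩ := hgood c (mem_filter.2 ⟨hc, hg⟩)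
      exact ⟨k.succ, hk⟩

open Finset in
/-- If every `c ∈ C` is bad for at most a quarter of all elements, there are many pairwise
disjoint small families each of which has a good element for every `c ∈ C`. -/
theorem exists_disjoint_hitting_families {ι κ : Type*} [Fintype ι] [Nonempty ι] [DecidableEq ι]
    (good : ι → κ → Prop) [∀ i c, Decidable (good i c)] (K : ℕ) (C : Finset κ) (hK : #C < 2 ^ K)
    (h : ∀ c ∈ C, 4 * #{i | ¬ good i c} ≤ Fintype.card ι) (a : ℕ)
    (ha : 2 * ((a - 1) * K) ≤ Fintype.card ι) :
    ∃ τ : Fin a → Fin K → ι, (∀ i j k l, τ i k = τ j l → i = j) ∧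
      ∀ i, ∀ c ∈ C, ∃ k, good (τ i k) c := by
  induction a with
  | zero => exact ⟨Fin.elim0, fun i => i.elim0, fun i => i.elim0⟩
  | succ a ih =>
    rw [Nat.add_sub_cancel] at ha
    obtain ⟨τ, hinj, hgood⟩ := ih
      ((Nat.mul_le_mul_left 2 (Nat.mul_le_mul_right K (Nat.sub_le a 1))).trans ha)
    -- The earlier families occupy at most half of `ι`, so a quarter of `ι` is at most half of the
    -- complement and a further family can be chosen there.
    set used : Finset ι := univ.image fun q : Fin a × Fin K => τ q.1 q.2 with hused
    have hcard : #used ≤ a * K := card_image_le.trans (by simp)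
    have hcompl : #usedᶜ + #used = Fintype.card ι := by
      rw [card_compl, Nat.sub_add_cancel (card_le_univ used)]
    have hpos : 0 < Fintype.card ι := Fintype.card_pos
    obtain ⟨σ, hσ, hσgood⟩ := exists_hitting_family good usedᶜ (card_pos.1 (by omega)) K C hK
      fun c hc => by
        have h1 := card_filter_add_card_filter_not (s := usedᶜ) (fun i => good i c)
        have h2 : #{i ∈ usedᶜ | ¬ good i c} ≤ #{i | ¬ good i c} :=
          card_le_card (filter_subset_filter _ (subset_univ _))
        have h3 := h c hc
        omega
    have hne : ∀ i k l, τ i k ≠ σ l := fun i k l heq =>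
      (mem_compl.1 (hσ l)) (heq ▸ mem_image.2 ⟨(i, k), mem_univ _, rfl⟩)
    refine ⟨Fin.cons σ τ, fun i j => ?_, Fin.cases hσgood hgood⟩
    refine Fin.cases ?_ (fun i => ?_) i <;> refine Fin.cases ?_ (fun j => ?_) j <;> intro k l heq
    · rfl
    · exact absurd heq.symm (hne j l k)
    · exact absurd heq (hne i k l)
    · rw [hinj i j k l heq]

open Finset in
/-- Markov's inequality for counting: if the sum of the values is at most `t * x`, the number of
values above `x`, times `x`, is at most `t * x`. -/
theorem card_filter_lt_mul_le {ι : Type*} (s : Finset ι) (w : ι → ℝ) (hw : ∀ i, 0 ≤ w i)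
    (x t : ℝ) (hsum : ∑ i ∈ s, w i ≤ t * x) :
    (#{i ∈ s | x < w i} : ℝ) * x ≤ t * x :=
  calc (#{i ∈ s | x < w i} : ℝ) * x = ∑ i ∈ s with x < w i, x := by simp
    _ ≤ ∑ i ∈ s with x < w i, w i := sum_le_sum fun i hi => (mem_filter.1 hi).2.le
    _ ≤ ∑ i ∈ s, w i := sum_le_sum_of_subset_of_nonneg (filter_subset _ _) fun i _ _ => hw i
    _ ≤ t * x := hsum

open Finset in
/-- From a matrix with small average, select `b` columns and `a` disjoint families of `K` rows so
that each selected column has a small entry in each of the families. -/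
theorem exists_small_entries {ι κ : Type*} [Fintype ι] [Fintype κ] [Nonempty ι] [Nonempty κ]
    (w : ι → κ → ℝ) (hw : ∀ i c, 0 ≤ w i c) {ε : ℝ} (hε : 0 < ε)
    (hsum : ∑ i, ∑ c, w i c ≤ ε * (Fintype.card ι * Fintype.card κ)) (a b K : ℕ)
    (hb : 2 * (b - 1) < Fintype.card κ) (hK : b < 2 ^ K)
    (ha : 2 * ((a - 1) * K) ≤ Fintype.card ι) :
    ∃ (s : Fin b → κ) (τ : Fin a → Fin K → ι), Function.Injective s ∧
      (∀ i j k l, τ i k = τ j l → i = j) ∧ ∀ i c, ∃ k, w (τ i k) (s c) ≤ 8 * ε := by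
  classical
  have hι : (0 : ℝ) < Fintype.card ι := by exact_mod_cast Fintype.card_pos
  have hκ : 0 < Fintype.card κ := Fintype.card_pos
  -- Twice the bound on the mean column sum, so at least half of the columns stay below it. In such
  -- a column at most a quarter of the entries exceed `8 * ε`.
  set x : ℝ := 2 * ε * Fintype.card ι with hx
  have hx0 : 0 < x := by positivity
  set good : Finset κ := {c | ¬ x < ∑ i, w i c} with hgood
  have hbad : 2 * #{c | x < ∑ i, w i c} ≤ Fintype.card κ := by
    have := card_filter_lt_mul_le univ (fun c => ∑ i, w i c)
      (fun c => sum_nonneg fun i _ => hw i c) x (Fintype.card κ / 2) (by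
        rw [sum_comm]; refine hsum.trans (le_of_eq ?_); rw [hx]; ring)
    have := le_of_mul_le_mul_right this hx0
    have h2 : (2 * #{c | x < ∑ i, w i c} : ℝ) ≤ Fintype.card κ := by linarith
    exact_mod_cast h2
  have hsplit : #{c | x < ∑ i, w i c} + #good = Fintype.card κ := by
    rw [hgood, card_filter_add_card_filter_not, card_univ]
  obtain ⟨C, hC, hCb⟩ := exists_subset_card_eq (s := good) (n := b) (by omega)
  obtain ⟨τ, hτ, hτC⟩ := exists_disjoint_hitting_families (fun i c => w i c ≤ 8 * ε) K C
    (by omega) (fun c hc => by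
      have hc' : ∑ i, w i c ≤ x := not_lt.1 (mem_filter.1 (hC hc)).2
      have := card_filter_lt_mul_le univ (fun i => w i c) (fun i => hw i c) (8 * ε)
        (Fintype.card ι / 4) (hc'.trans (le_of_eq (by rw [hx]; ring)))
      have := le_of_mul_le_mul_right this (by positivity)
      have h4 : (4 * #{i | 8 * ε < w i c} : ℝ) ≤ Fintype.card ι := by linarith
      simp only [not_le]
      exact_mod_cast h4) a ha
  refine ⟨fun c => (C.equivFinOfCardEq hCb).symm c, τ,
    Subtype.val_injective.comp (Equiv.injective _), hτ, fun i c => hτC i _ (Subtype.prop _)⟩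

/-! ### Product measures and their marginals -/

open MeasureTheory in
/-- Tonelli's theorem for a product of functions of one coordinate each. -/
theorem lintegral_pi_prod_eq_prod {n : ℕ} {Y : Type*} [MeasurableSpace Y]
    (μ : Fin n → Measure Y) [∀ t, SigmaFinite (μ t)] (q : Fin n → Y → ℝ≥0∞)
    (hq : ∀ t, Measurable (q t)) :
    ∫⁻ y, ∏ t, q t (y t) ∂(Measure.pi μ) = ∏ t, ∫⁻ y, q t y ∂(μ t) := by
  induction n with
  | zero => simp
  | succ n ih =>
    rw [← ((measurePreserving_piFinSuccAbove μ 0).symm).lintegral_comp_emb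
      (MeasurableEquiv.measurableEmbedding _)]
    simp_rw [MeasurableEquiv.piFinSuccAbove_symm_apply, Fin.insertNthEquiv,
      Fin.prod_univ_succ, Fin.insertNth_zero]
    simp only [Fin.zero_succAbove, Equiv.coe_fn_mk, Fin.cons_zero, Fin.cons_succ, cast_eq]
    refine (lintegral_prod_mul (f := q 0) (g := fun z : Fin n → Y => ∏ t, q (Fin.succ t) (z t))
      (hq 0).aemeasurable (Finset.measurable_prod _
        fun t _ => (hq t.succ).comp (measurable_pi_apply t)).aemeasurable).trans ?_
    rw [ih _ _ fun t => hq t.succ]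

open MeasureTheory in
/-- A product measure restricts to the product measure on a subset of the coordinates. -/
theorem measurePreserving_comp_embedding_pi {ι κ Y : Type*} [Fintype ι] [Fintype κ]
    [MeasurableSpace Y] (μ : ι → Measure Y) [∀ i, IsProbabilityMeasure (μ i)] (e : κ ↪ ι) :
    MeasurePreserving (fun (y : ι → Y) k => y (e k)) (Measure.pi μ)
      (Measure.pi fun k => μ (e k)) := by
  classical
  have hm : Measurable fun (y : ι → Y) k => y (e k) := by fun_prop
  refine ⟨hm, (Measure.pi_eq fun s hs => ?_).symm⟩
  rw [Measure.map_apply hm (MeasurableSet.univ_pi hs)]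
  -- The preimage of a box is a box. Coordinates outside the range of `e` carry an empty
  -- intersection, hence the whole space with mass one.
  have hpre : (fun (y : ι → Y) k => y (e k)) ⁻¹' Set.univ.pi s =
      Set.univ.pi fun i => ⋂ k, ⋂ _ : e k = i, s k := by
    ext y
    simp only [Set.mem_preimage, Set.mem_pi, Set.mem_univ, true_imp_iff, Set.mem_iInter]
    exact ⟨fun h i k hk => hk ▸ h k, fun h k => h _ k rfl⟩
  rw [hpre, Measure.pi_pi, ← Finset.prod_subset (Finset.subset_univ (Finset.univ.map e)),
    Finset.prod_map]
  · refine Finset.prod_congr rfl fun k _ => congrArg _ ?_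
    ext y
    simp
  · intro i _ hi
    have : (⋂ k, ⋂ _ : e k = i, s k) = Set.univ := by
      refine Set.eq_univ_of_forall fun y => Set.mem_iInter₂.2 fun k hk => ?_
      exact absurd (Finset.mem_map.2 ⟨k, Finset.mem_univ _, hk⟩) hi
    rw [this, measure_univ]

/-! ### The output law of the memoryless channel -/

namespace MAC

variable {X : Fin 2 → Type u} {Y : Type v} [MeasurableSpace Y]

/-- The law of the channel output on the input pair `x`. -/
noncomputable def law (W : MAC X Y) (x : ∀ i, X i) : MeasureTheory.Measure Y :=
  W.ν.withDensity fun y => W.p x y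

instance isProbabilityMeasure_law (W : MAC X Y) (x : ∀ i, X i) :
    MeasureTheory.IsProbabilityMeasure (W.law x) :=
  ⟨by rw [law, MeasureTheory.withDensity_apply _ MeasurableSet.univ,
    MeasureTheory.Measure.restrict_univ, W.lintegral_p]⟩

/-- The law of the output word of the memoryless channel on the input word `x`. -/
noncomputable def outputLaw (W : MAC X Y) {n : ℕ} (x : Fin n → ∀ i, X i) :
    MeasureTheory.Measure (Fin n → Y) :=
  MeasureTheory.Measure.pi fun t => W.law (x t)

instance isProbabilityMeasure_outputLaw (W : MAC X Y) {n : ℕ} (x : Fin n → ∀ i, X i) :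
    MeasureTheory.IsProbabilityMeasure (W.outputLaw x) :=
  inferInstanceAs (MeasureTheory.IsProbabilityMeasure (MeasureTheory.Measure.pi _))

-- Makes an error probability, defined by integrating a density, the measure of an event under a
-- product of probability measures, where marginals and union bounds apply. The densities factor
-- over boxes by Tonelli.
open MeasureTheory in
theorem outputLaw_eq_withDensity (W : MAC X Y) {n : ℕ} (x : Fin n → ∀ i, X i) :
    W.outputLaw x = (Measure.pi fun _ => W.ν).withDensity
      fun y => ∏ t, (W.p (x t) (y t) : ℝ≥0∞) := by
  have := W.sigmaFinite
  refine Measure.pi_eq fun s hs => ?_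
  rw [withDensity_apply _ (MeasurableSet.univ_pi hs), Measure.restrict_pi_pi,
    lintegral_pi_prod_eq_prod _ (fun t y => (W.p (x t) y : ℝ≥0∞))
      fun t => (W.measurable_p _).coe_nnreal_ennreal]
  exact Finset.prod_congr rfl fun t _ => (withDensity_apply _ (hs t)).symm

/-- The probability that an event holds for the output word. -/
noncomputable def outputProb (W : MAC X Y) {n : ℕ} (x : Fin n → ∀ i, X i)
    (s : Set (Fin n → Y)) : ℝ :=
  (W.outputLaw x s).toReal

theorem outputProb_nonneg (W : MAC X Y) {n : ℕ} (x : Fin n → ∀ i, X i) (s : Set (Fin n → Y)) :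
    0 ≤ W.outputProb x s :=
  ENNReal.toReal_nonneg

/-- Union bound for events about the two parts of a word sent in two parts. -/
theorem outputProb_append_le (W : MAC X Y) {n₁ n₂ : ℕ} (x : Fin (n₁ + n₂) → ∀ i, X i)
    (s : Set (Fin (n₁ + n₂) → Y)) {s₁ : Set (Fin n₁ → Y)} {s₂ : Set (Fin n₂ → Y)}
    (h₁ : MeasurableSet s₁) (h₂ : MeasurableSet s₂)
    (hs : ∀ y ∈ s, (fun t => y (Fin.castAdd n₂ t)) ∈ s₁ ∨ (fun t => y (Fin.natAdd n₁ t)) ∈ s₂) :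
    W.outputProb x s ≤ W.outputProb (fun t => x (Fin.castAdd n₂ t)) s₁ +
      W.outputProb (fun t => x (Fin.natAdd n₁ t)) s₂ := by
  have m₁ := measurePreserving_comp_embedding_pi (fun t => W.law (x t)) (Fin.castAddEmb n₂)
  have m₂ := measurePreserving_comp_embedding_pi (fun t => W.law (x t)) (Fin.natAddEmb n₁)
  rw [outputProb, outputProb, outputProb, ← ENNReal.toReal_add (MeasureTheory.measure_ne_top _ _)
    (MeasureTheory.measure_ne_top _ _)]
  refine ENNReal.toReal_mono (ENNReal.add_ne_top.2 ⟨MeasureTheory.measure_ne_top _ _,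
    MeasureTheory.measure_ne_top _ _⟩) ?_
  refine (MeasureTheory.measure_mono hs).trans ((MeasureTheory.measure_union_le
    ((fun (y : Fin (n₁ + n₂) → Y) t => y (Fin.castAdd n₂ t)) ⁻¹' s₁)
    ((fun (y : Fin (n₁ + n₂) → Y) t => y (Fin.natAdd n₁ t)) ⁻¹' s₂)).trans ?_)
  exact add_le_add (m₁.measure_preimage h₁.nullMeasurableSet).le
    (m₂.measure_preimage h₂.nullMeasurableSet).le

end MAC

/-! ### Codes without cooperation and the time sharing code -/

namespace CFCode

variable {X : Fin 2 → Type u} {Y : Type v} [MeasurableSpace Y] {n : ℕ} {M : Fin 2 → ℕ} {J : ℕ}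

theorem measurableSet_error (c : CFCode X Y n M J) (m : ∀ i, Fin (M i)) :
    MeasurableSet {y : Fin n → Y | c.g y ≠ m} :=
  c.measurable_g (measurableSet_singleton m).compl

theorem errorProb_eq (c : CFCode X Y n M J) (W : MAC X Y) (m : ∀ i, Fin (M i)) :
    c.errorProb W m = W.outputProb (c.input m) {y | c.g y ≠ m} := by
  rw [errorProb, MAC.outputProb, W.outputLaw_eq_withDensity,
    MeasureTheory.withDensity_apply _ (c.measurableSet_error m)]

theorem errorProb_le_maxError (c : CFCode X Y n M J) (W : MAC X Y) (m : ∀ i, Fin (M i)) :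
    c.errorProb W m ≤ c.maxError W :=
  le_ciSup (Set.finite_range _).bddAbove m

end CFCode

/-- A code without cooperation: codewords `f i m` and a decoder `g`. -/
structure BlockCode (X : Fin 2 → Type u) (Y : Type v) [MeasurableSpace Y]
    (n : ℕ) (M : Fin 2 → ℕ) where
  /-- the encoders -/
  f : ∀ i : Fin 2, Fin (M i) → Fin n → X i
  /-- the decoder -/
  g : (Fin n → Y) → ∀ i, Fin (M i)
  measurable_g : Measurable g

section

variable {X : Fin 2 → Type u} {Y : Type v} [MeasurableSpace Y] {n : ℕ} {M : Fin 2 → ℕ} {J : ℕ}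

namespace BlockCode

/-- The probability that the message pair `m` is decoded incorrectly. -/
noncomputable def errorProb (b : BlockCode X Y n M) (W : MAC X Y) (m : ∀ i, Fin (M i)) : ℝ :=
  W.outputProb (fun t i => b.f i (m i) t) {y | b.g y ≠ m}

theorem errorProb_nonneg (b : BlockCode X Y n M) (W : MAC X Y) (m : ∀ i, Fin (M i)) :
    0 ≤ b.errorProb W m :=
  W.outputProb_nonneg _ _

/-- A code without cooperation as a code with a facilitator that exchanges only constants. -/
def toCFCode (b : BlockCode X Y n M) (J : ℕ) : CFCode X Y n M J where
  uCard _ _ := 1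
  vCard _ _ := 1
  φ _ _ _ _ := 0
  ψ _ _ _ := 0
  f i m _ := b.f i m
  g := b.g
  measurable_g := b.measurable_g

theorem toCFCode_respects (b : BlockCode X Y n M) (J : ℕ) (Cin Cout : Fin 2 → ℝ≥0) :
    (b.toCFCode J).Respects Cin Cout := by
  intro i
  simp only [toCFCode, Nat.cast_one, Real.logb_one, Finset.sum_const_zero]
  exact ⟨by positivity, by positivity⟩

theorem errorProb_toCFCode (b : BlockCode X Y n M) (J : ℕ) (W : MAC X Y) (m : ∀ i, Fin (M i)) :
    (b.toCFCode J).errorProb W m = b.errorProb W m :=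
  CFCode.errorProb_eq _ _ _

end BlockCode

namespace CFCode

/-- If the facilitator cannot send anything, its answers do not depend on the messages. -/
theorem exists_blockCode (c : CFCode X Y n M J) (hM : ∀ i, 1 ≤ M i) {Cin : Fin 2 → ℝ≥0}
    (hc : c.Respects Cin 0) (W : MAC X Y) :
    ∃ b : BlockCode X Y n M, ∀ m, b.errorProb W m = c.errorProb W m := by
  -- The logarithms are nonnegative, also for size `0` since `Real.logb 2 0 = 0`, and their sum is
  -- at most zero, so no alphabet has two symbols.
  have hv : ∀ i j, c.vCard i j ≤ 1 := fun i j => by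
    have hnn : ∀ l ∈ Finset.univ, 0 ≤ Real.logb 2 (c.vCard i l) := fun l _ => by
      rcases Nat.eq_zero_or_pos (c.vCard i l) with h0 | h1
      · simp [h0]
      · exact Real.logb_nonneg one_lt_two (by exact_mod_cast h1)
    have h0 : ∑ l, Real.logb 2 (c.vCard i l) ≤ 0 := by simpa using (hc i).2
    have hj : Real.logb 2 (c.vCard i j) ≤ 0 :=
      (Finset.single_le_sum hnn (Finset.mem_univ j)).trans h0
    by_contra! h1
    exact hj.not_gt (Real.logb_pos one_lt_two (by exact_mod_cast h1))
  have hconst : ∀ m m' i, c.cfSymbol m i = c.cfSymbol m' i := fun m m' i => funext fun j =>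
    Fin.ext (by have := (c.cfSymbol m i j).2; have := (c.cfSymbol m' i j).2
                have := hv i j; omega)
  set m₀ : ∀ i, Fin (M i) := fun i => ⟨0, hM i⟩
  refine ⟨⟨fun i a => c.f i a (c.cfSymbol m₀ i), c.g, c.measurable_g⟩, fun m => ?_⟩
  rw [errorProb_eq, BlockCode.errorProb]
  congr 1
  funext t i
  rw [input, hconst m m₀]

/-- Time sharing. First a code `A` is used without cooperation. Then the facilitator learns message
pairs `l` completely, tells encoder `i` the index `sel l i` of one of its `κ i` representatives
`σ i (l i) k` of its message in a code `B`, and the representatives are sent with `B`. -/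
def timeShare {n₁ n₂ : ℕ} {M N L κ : Fin 2 → ℕ} (A : BlockCode X Y n₁ M) (B : BlockCode X Y n₂ N)
    (σ : ∀ i, Fin (L i) → Fin (κ i) → Fin (N i)) (ρ : ∀ i, Fin (N i) → Fin (L i))
    (sel : (∀ i, Fin (L i)) → ∀ i, Fin (κ i)) :
    CFCode X Y (n₁ + n₂) (fun i => M i * L i) 1 where
  uCard i _ := L i
  vCard i _ := κ i
  φ _ _ m _ := (finProdFinEquiv.symm m).2
  ψ i j u := sel (fun k => u k j le_rfl) i
  f i m v := Fin.append (A.f i (finProdFinEquiv.symm m).1)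
    (B.f i (σ i (finProdFinEquiv.symm m).2 (v 0)))
  -- The decoder needs no knowledge of the facilitator's choice: `ρ` is meant to send every
  -- representative back to its message.
  g y i := finProdFinEquiv (A.g (fun t => y (Fin.castAdd n₂ t)) i,
    ρ i (B.g (fun t => y (Fin.natAdd n₁ t)) i))
  measurable_g := by
    have hA : Measurable fun y : Fin (n₁ + n₂) → Y => A.g fun t => y (Fin.castAdd n₂ t) :=
      A.measurable_g.comp (by fun_prop)
    have hB : Measurable fun y : Fin (n₁ + n₂) → Y => B.g fun t => y (Fin.natAdd n₁ t) :=
      B.measurable_g.comp (by fun_prop)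
    have hd : Measurable fun (q : (∀ i, Fin (M i)) × (∀ i, Fin (N i))) (i : Fin 2) =>
        finProdFinEquiv (q.1 i, ρ i (q.2 i)) := .of_discrete
    exact hd.comp (hA.prodMk hB)

theorem errorProb_timeShare_le {n₁ n₂ : ℕ} {M N L κ : Fin 2 → ℕ} (A : BlockCode X Y n₁ M)
    (B : BlockCode X Y n₂ N) (σ : ∀ i, Fin (L i) → Fin (κ i) → Fin (N i))
    (ρ : ∀ i, Fin (N i) → Fin (L i)) (hρ : ∀ i l k, ρ i (σ i l k) = l)
    (sel : (∀ i, Fin (L i)) → ∀ i, Fin (κ i)) (W : MAC X Y) (m : ∀ i, Fin (M i * L i)) :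
    (timeShare A B σ ρ sel).errorProb W m ≤
      A.errorProb W (fun i => (finProdFinEquiv.symm (m i)).1) +
      B.errorProb W (fun i => σ i (finProdFinEquiv.symm (m i)).2
        (sel (fun k => (finProdFinEquiv.symm (m k)).2) i)) := by
  set l : ∀ i, Fin (L i) := fun k => (finProdFinEquiv.symm (m k)).2 with hl
  have hsym : ∀ i j, (timeShare A B σ ρ sel).cfSymbol m i j = sel l i := fun i j => by
    rw [cfSymbol_eq]; rfl
  rw [errorProb_eq]
  refine (W.outputProb_append_le _ _
    (s₁ := {y | A.g y ≠ fun i => (finProdFinEquiv.symm (m i)).1})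
    (s₂ := {y | B.g y ≠ fun i => σ i (l i) (sel l i)})
    (A.measurable_g (measurableSet_singleton _).compl)
    (B.measurable_g (measurableSet_singleton _).compl) fun y hy => ?_).trans (le_of_eq ?_)
  · by_contra! hcon
    obtain ⟨h₁, h₂⟩ := hcon
    simp only [Set.mem_ofPred_eq, not_not] at h₁ h₂
    refine hy (funext fun i => ?_)
    simp only [timeShare, h₁, h₂, hρ, hl, Prod.mk.eta, Equiv.apply_symm_apply]
  · congr 2
    · funext t i
      simp [input, timeShare]
    · funext t i
      change Fin.append _ (B.f i (σ i (l i) ((timeShare A B σ ρ sel).cfSymbol m i 0)))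
        (Fin.natAdd n₁ t) = _
      rw [Fin.append_right, hsym]

end CFCode

/-- The message selection behind time sharing: from a code with small average error, representatives
of new messages such that each pair of new messages has representatives with small error. -/
theorem BlockCode.exists_representatives {N : Fin 2 → ℕ} (hN : ∀ i, 1 ≤ N i)
    (B : BlockCode X Y n N) (W : MAC X Y) {ε : ℝ} (hε : 0 < ε)
    (hsum : ∑ m, B.errorProb W m ≤ ε * (N 0 * N 1)) (L : Fin 2 → ℕ) (K : ℕ)
    (hL : ∀ i, 1 ≤ L i) (h₁ : 2 * (L 1 - 1) < N 1) (hK : L 1 < 2 ^ K)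
    (h₀ : 2 * ((L 0 - 1) * K) ≤ N 0) :
    ∃ (σ : ∀ i, Fin (L i) → Fin ((![K, 1] : Fin 2 → ℕ) i) → Fin (N i))
      (ρ : ∀ i, Fin (N i) → Fin (L i)) (sel : (∀ i, Fin (L i)) → ∀ i, Fin ((![K, 1] : Fin 2 → ℕ) i)),
      (∀ i l k, ρ i (σ i l k) = l) ∧
      ∀ l, B.errorProb W (fun i => σ i (l i) (sel l i)) ≤ 8 * ε := by
  have : ∀ i, NeZero (N i) := fun i => ⟨Nat.one_le_iff_ne_zero.1 (hN i)⟩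
  have : ∀ i, NeZero (L i) := fun i => ⟨Nat.one_le_iff_ne_zero.1 (hL i)⟩
  let e := (piFinTwoEquiv fun i => Fin (N i)).symm
  obtain ⟨s, τ, hs, hτ, hsmall⟩ := exists_small_entries (fun a c => B.errorProb W (e (a, c)))
    (fun a c => B.errorProb_nonneg W _) hε
    (by rw [← Fintype.sum_prod_type', Fintype.card_fin, Fintype.card_fin]
        exact (e.sum_comp fun m => B.errorProb W m).trans_le hsum)
    (L 0) (L 1) K (by simpa using h₁) hK (by simpa using h₀)
  choose k hk using hsmall
  classical
  -- Only encoder `0` has several representatives. Disjointness of the families makes the first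
  -- component of the chosen pair unique; the value `0` off the families is arbitrary.
  refine ⟨fun | 0 => τ | 1 => fun c _ => s c,
    fun | 0 => fun r => if h : ∃ q : Fin (L 0) × Fin K, τ q.1 q.2 = r then h.choose.1 else 0
        | 1 => Function.invFun s,
    fun l => fun | 0 => k (l 0) (l 1) | 1 => (0 : Fin 1), ?_, fun l => ?_⟩
  · refine Fin.forall_fin_two.2 ⟨fun l j => ?_, fun l j => Function.leftInverse_invFun hs l⟩
    have h : ∃ q : Fin (L 0) × Fin K, τ q.1 q.2 = τ l j := ⟨(l, j), rfl⟩
    exact (dif_pos h).trans (hτ _ _ _ _ h.choose_spec)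
  · refine le_of_eq_of_le (congrArg _ (funext ?_)) (hk (l 0) (l 1))
    exact Fin.forall_fin_two.2 ⟨rfl, rfl⟩

end

/-! ### Growth estimates -/

/-- Exponentials of positive rate dominate affine functions. -/
theorem eventually_mul_add_le_two_rpow (c d : ℝ) {e : ℝ} (he : 0 < e) :
    ∀ᶠ n : ℕ in Filter.atTop, c * n + d ≤ (2 : ℝ) ^ ((n : ℝ) * e) := by
  have hr : (1 : ℝ) < 2 ^ e := Real.one_lt_rpow one_lt_two he
  have hpos : 0 < |c| + |d| + 1 := by positivity
  -- The little-o constant is chosen to give `(|c| + |d| + 1) * n ≤ (2 ^ e) ^ n`; for `n ≥ 1` the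
  -- left side dominates `c * n + d`.
  filter_upwards [(isLittleO_coe_const_pow_of_one_lt (R := ℝ) hr).bound (inv_pos.2 hpos),
    Filter.eventually_ge_atTop 1] with n hn h1
  have h1' : (1 : ℝ) ≤ n := by exact_mod_cast h1
  rw [mul_comm (n : ℝ) e, Real.rpow_mul_natCast zero_le_two]
  rw [Real.norm_of_nonneg (by positivity), Real.norm_of_nonneg (by positivity),
    inv_mul_eq_div, le_div_iff₀ hpos] at hn
  nlinarith [le_abs_self c, le_abs_self d, abs_nonneg d]

/-- The number of messages used for an exponent `x`. -/
theorem floor_two_rpow_add_one_bounds (x z : ℝ) (hxz : x ≤ z) (hz : 0 ≤ z) :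
    x ≤ Real.logb 2 ((⌊(2 : ℝ) ^ x⌋₊ + 1 : ℕ) : ℝ) ∧
      Real.logb 2 ((⌊(2 : ℝ) ^ x⌋₊ + 1 : ℕ) : ℝ) ≤ z + 1 := by
  have hfl : (⌊(2 : ℝ) ^ x⌋₊ : ℝ) ≤ 2 ^ x := Nat.floor_le (by positivity)
  have hmono : (2 : ℝ) ^ x ≤ 2 ^ z := Real.rpow_le_rpow_of_exponent_le one_le_two hxz
  have hone : (1 : ℝ) ≤ 2 ^ z := Real.one_le_rpow one_le_two hz
  constructor
  · rw [Real.le_logb_iff_rpow_le one_lt_two (by positivity)]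
    push_cast
    exact (Nat.lt_floor_add_one _).le
  · rw [Real.logb_le_iff_le_rpow one_lt_two (by positivity), Real.rpow_add two_pos, Real.rpow_one]
    push_cast
    linarith

/-! ### Achievability by time sharing -/

namespace MAC

variable {X : Fin 2 → Type u} {Y : Type v} [MeasurableSpace Y] {J : ℕ}

/-- One blocklength of the time sharing scheme: from a maximal-error code of length `n₁` and an
average-error code of length `n₂` without cooperation, a maximal-error code of length `n₁ + n₂`
with a facilitator that sends at most `log₂ (log₂ L₁ + 1)` bits to the first encoder only. -/
theorem exists_timeShare_code (W : MAC X Y) {n₁ n₂ : ℕ} {M N : Fin 2 → ℕ}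
    (hM : ∀ i, 1 ≤ M i) (hN : ∀ i, 1 ≤ N i) (A : BlockCode X Y n₁ M) (B : BlockCode X Y n₂ N)
    {ε : ℝ} (hε : 0 < ε) (hA : ∀ m, A.errorProb W m ≤ ε / 2)
    (hB : ∑ m, B.errorProb W m ≤ ε / 16 * (N 0 * N 1)) (L : Fin 2 → ℕ) (hL : ∀ i, 1 ≤ L i)
    (h₁ : 2 * (L 1 - 1) < N 1) (h₀ : 2 * ((L 0 - 1) * (Nat.log 2 (L 1) + 1)) ≤ N 0)
    (Cin Cout : Fin 2 → ℝ≥0) (hCin : ∀ i, Real.logb 2 (L i) ≤ (n₁ + n₂ : ℕ) * Cin i)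
    (hCout : Real.logb 2 (Nat.log 2 (L 1) + 1 : ℕ) ≤ (n₁ + n₂ : ℕ) * Cout 0) :
    ∃ c : CFCode X Y (n₁ + n₂) (fun i => M i * L i) 1, c.Respects Cin Cout ∧ c.maxError W ≤ ε := by
  -- The selection multiplies the average error by `8`, so `ε / 16` becomes `ε / 2`, and `A` uses
  -- the other half.
  obtain ⟨σ, ρ, sel, hρ, hsel⟩ := B.exists_representatives hN W (by positivity : 0 < ε / 16) hB L
    (Nat.log 2 (L 1) + 1) hL h₁ (Nat.lt_pow_succ_log_self one_lt_two _) h₀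
  refine ⟨CFCode.timeShare A B σ ρ sel, fun i => ⟨?_, ?_⟩, ?_⟩
  · simpa [CFCode.timeShare] using hCin i
  · revert i
    refine Fin.forall_fin_two.2 ⟨?_, ?_⟩
    · simpa [CFCode.timeShare] using hCout
    · simp only [CFCode.timeShare, Finset.univ_unique, Finset.sum_const, Finset.card_singleton,
        one_smul, Matrix.cons_val_one, Matrix.cons_val_fin_one, Nat.cast_one, Real.logb_one]
      positivity
  · have : Nonempty (∀ i, Fin (M i * L i)) :=
      ⟨fun i => ⟨0, Nat.mul_pos (hM i) (hL i)⟩⟩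
    refine ciSup_le fun m => (CFCode.errorProb_timeShare_le A B σ ρ hρ sel W m).trans ?_
    have := hA fun i => (finProdFinEquiv.symm (m i)).1
    have := hsel fun k => (finProdFinEquiv.symm (m k)).2
    linarith

theorem exists_blockCode_of_maxError (W : MAC X Y) {R : Fin 2 → ℝ} {Cin : Fin 2 → ℝ≥0}
    (h : W.MaxAchievable Cin 0 J R) {ε δ : ℝ} (hε : 0 < ε) (hδ : 0 < δ) :
    ∀ᶠ n : ℕ in Filter.atTop, ∃ (M : Fin 2 → ℕ) (b : BlockCode X Y n M), (∀ i, 1 ≤ M i) ∧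
      (∀ i, n * (R i - δ) ≤ Real.logb 2 (M i)) ∧ ∀ m, b.errorProb W m ≤ ε := by
  obtain ⟨N, hN⟩ := h ε hε δ hδ
  filter_upwards [Filter.eventually_ge_atTop N, Filter.eventually_gt_atTop 0] with n hn hn0
  obtain ⟨M, c, hM, hc, hR, hmax⟩ := hN n hn
  obtain ⟨b, hb⟩ := c.exists_blockCode hM hc W
  refine ⟨M, b, hM, fun i => ?_, fun m => hb m ▸ (c.errorProb_le_maxError W m).trans hmax⟩
  have := hR i
  rwa [one_div, inv_mul_eq_div, le_div_iff₀' (by exact_mod_cast hn0)] at this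

/-- The error bound is kept as a sum over the message matrix, the form the counting argument takes.
-/
theorem exists_blockCode_of_avgError (W : MAC X Y) {R : Fin 2 → ℝ} {Cin : Fin 2 → ℝ≥0}
    (h : W.AvgAchievable Cin 0 J R) {ε δ : ℝ} (hε : 0 < ε) (hδ : 0 < δ) :
    ∀ᶠ n : ℕ in Filter.atTop, ∃ (M : Fin 2 → ℕ) (b : BlockCode X Y n M), (∀ i, 1 ≤ M i) ∧
      (∀ i, n * (R i - δ) ≤ Real.logb 2 (M i)) ∧ ∑ m, b.errorProb W m ≤ ε * (M 0 * M 1) := by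
  obtain ⟨N, hN⟩ := h ε hε δ hδ
  filter_upwards [Filter.eventually_ge_atTop N, Filter.eventually_gt_atTop 0] with n hn hn0
  obtain ⟨M, c, hM, hc, hR, havg⟩ := hN n hn
  obtain ⟨b, hb⟩ := c.exists_blockCode hM hc W
  refine ⟨M, b, hM, fun i => ?_, ?_⟩
  · have := hR i
    rwa [one_div, inv_mul_eq_div, le_div_iff₀' (by exact_mod_cast hn0)] at this
  · have h0 : (0 : ℝ) < M 0 := by exact_mod_cast hM 0
    have h1 : (0 : ℝ) < M 1 := by exact_mod_cast hM 1
    rw [Finset.sum_congr rfl fun m _ => hb m]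
    exact (div_le_iff₀ (by positivity)).1 havg

/-- The rate pairs on the segment between a pair achievable without cooperation under maximal error
and one achievable without cooperation under average error are achievable under maximal error when
the facilitator can learn the messages of the second code and send any positive rate to the first
encoder. -/
theorem maxAchievable_timeShare (W : MAC X Y) {J' : ℕ} {S R : Fin 2 → ℝ} (hS0 : 0 ≤ S)
    (hR0 : 0 ≤ R) (hS : W.MaxAchievable 0 0 J S) (hR : W.AvgAchievable 0 0 J' R) {β : ℝ}
    (hβ : β ∈ Set.Ioo (0 : ℝ) 1) (Cin Cout : Fin 2 → ℝ≥0) (hCin : ∀ i, β * R i < Cin i)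
    (hCout : 0 < Cout 0) :
    W.MaxAchievable Cin Cout 1 fun i => (1 - β) * S i + β * R i := by
  intro ε hε δ hδ
  obtain ⟨hβ0, hβ1⟩ := hβ
  have hδ4 : 0 < δ / 4 := by positivity
  have hn₂ : Filter.Tendsto (fun n : ℕ => ⌊β * n⌋₊) Filter.atTop Filter.atTop :=
    tendsto_nat_floor_atTop.comp (tendsto_natCast_atTop_atTop.const_mul_atTop hβ0)
  -- Both parts of the block must grow for their codes to exist; the first has length at least `⌊(1
  -- - β) * n⌋₊`.
  have hn₁ : Filter.Tendsto (fun n : ℕ => n - ⌊β * n⌋₊) Filter.atTop Filter.atTop := by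
    refine Filter.tendsto_atTop_mono (fun n => ?_) (tendsto_nat_floor_atTop.comp
      ((tendsto_natCast_atTop_atTop (R := ℝ)).const_mul_atTop (sub_pos.2 hβ1)))
    have hle : ⌊β * n⌋₊ ≤ n := Nat.floor_le_of_le (by nlinarith [Nat.cast_nonneg (α := ℝ) n])
    refine Nat.floor_le_of_le ?_
    rw [Nat.cast_sub hle]
    linarith [Nat.floor_le (by positivity : 0 ≤ β * n)]
  have hlin : ∀ (c d : ℝ), 0 < c → ∀ᶠ n : ℕ in Filter.atTop, d ≤ n * c := fun c d hc =>
    (tendsto_natCast_atTop_atTop.atTop_mul_const hc).eventually_ge_atTop d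
  have hall : ∀ᶠ n : ℕ in Filter.atTop, ∃ (M : Fin 2 → ℕ) (c : CFCode X Y n M 1),
      (∀ i, 1 ≤ M i) ∧ c.Respects Cin Cout ∧
      (∀ i, (1 - β) * S i + β * R i - δ ≤ 1 / n * Real.logb 2 (M i)) ∧ c.maxError W ≤ ε := by
    filter_upwards [Filter.eventually_gt_atTop 0,
      hn₁.eventually (exists_blockCode_of_maxError W hS (half_pos hε) hδ4),
      hn₂.eventually (exists_blockCode_of_avgError W hR (by positivity : 0 < ε / 16) hδ4),
      hn₂.eventually (hlin _ 2 hδ4),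
      hn₂.eventually (eventually_mul_add_le_two_rpow (2 * R 1) 4 hδ4),
      Filter.eventually_all.2 fun i => hlin (Cin i - β * R i) 1 (sub_pos.2 (hCin i)),
      eventually_mul_add_le_two_rpow (R 1) 2 (NNReal.coe_pos.2 hCout),
      Filter.eventually_all.2 fun i => hlin (δ / 2) (R i) (by positivity)]
      with n hn hA hB hn₂δ hexp hin hout hrate
    have hn' : (0 : ℝ) < n := by exact_mod_cast hn
    have hfloor_le : (⌊β * n⌋₊ : ℝ) ≤ β * n := Nat.floor_le (by positivity)
    have hfloor_lt : β * n < ⌊β * n⌋₊ + 1 := Nat.lt_floor_add_one _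
    have hle : ⌊β * n⌋₊ ≤ n := Nat.floor_le_of_le (by nlinarith)
    obtain ⟨n₁, hn₁⟩ := exists_add_of_le hle
    rw [show n - ⌊β * n⌋₊ = n₁ by omega] at hA
    rw [add_comm] at hn₁
    generalize ⌊β * n⌋₊ = n₂ at *
    have hcast : (n : ℝ) = n₁ + n₂ := by exact_mod_cast hn₁
    obtain ⟨M, A, hM, hMr, hAe⟩ := hA
    obtain ⟨N, B, hN, hNr, hBe⟩ := hB
    -- `B` has at least `2 ^ (n₂ * (R i - δ / 4))` messages. The surplus factor `2 ^ (n₂ * (δ / 4))`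
    -- pays for the discarded columns and for the families of rows, whose size is at most affine in
    -- `n₂`.
    set x : Fin 2 → ℝ := fun i => n₂ * (R i - δ / 2) with hx
    -- The `+ 1` gives `log₂ (L i) ≥ x i` and keeps `L i` positive even when `x i` is negative.
    set L : Fin 2 → ℕ := fun i => ⌊(2 : ℝ) ^ x i⌋₊ + 1 with hLdef
    have hL1 : ∀ i, 1 ≤ L i := fun i => Nat.le_add_left 1 _
    have hn₂' : (0 : ℝ) ≤ n₂ := Nat.cast_nonneg _
    have hbounds : ∀ i, x i ≤ Real.logb 2 (L i) ∧ Real.logb 2 (L i) ≤ n₂ * R i + 1 := fun i =>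
      floor_two_rpow_add_one_bounds _ _ (mul_le_mul_of_nonneg_left (by linarith) hn₂')
        (mul_nonneg hn₂' (hR0 i))
    have hLx : ∀ i, ((L i - 1 : ℕ) : ℝ) ≤ 2 ^ x i := fun i => by
      rw [hLdef, Nat.add_sub_cancel]
      exact Nat.floor_le (by positivity)
    have hNx : ∀ i, (2 : ℝ) ^ x i * 2 ^ (n₂ * (δ / 4)) ≤ N i := fun i => by
      rw [← Real.rpow_add two_pos, ← Real.le_logb_iff_rpow_le one_lt_two
        (by exact_mod_cast hN i)]
      exact le_of_eq_of_le (by rw [hx]; ring) (hNr i)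
    have hfour : (4 : ℝ) ≤ 2 ^ (n₂ * (δ / 4)) :=
      le_of_eq_of_le (by norm_num) (Real.rpow_le_rpow_of_exponent_le one_le_two hn₂δ)
    have hxpos : ∀ i, (0 : ℝ) < 2 ^ x i := fun i => Real.rpow_pos_of_pos two_pos _
    have hK : ((Nat.log 2 (L 1) + 1 : ℕ) : ℝ) ≤ n₂ * R 1 + 2 := by
      have := Real.natLog_le_logb (L 1) 2
      push_cast at this ⊢
      linarith [(hbounds 1).2]
    have hR1 : 0 ≤ R 1 := hR0 1
    obtain ⟨c, hc, hce⟩ := exists_timeShare_code W hM hN A B hε hAe hBe L hL1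
      (by have : (2 * (L 1 - 1 : ℕ) : ℝ) < N 1 := by nlinarith [hLx 1, hNx 1, hxpos 1]
          exact_mod_cast this)
      (by have : (2 * ((L 0 - 1 : ℕ) * (Nat.log 2 (L 1) + 1 : ℕ)) : ℝ) ≤ N 0 :=
            calc (2 * ((L 0 - 1 : ℕ) * (Nat.log 2 (L 1) + 1 : ℕ)) : ℝ)
                ≤ 2 * (2 ^ x 0 * (n₂ * R 1 + 2)) := by
                  gcongr
                  exact hLx 0
              _ = 2 ^ x 0 * (2 * R 1 * n₂ + 4) := by ring
              _ ≤ 2 ^ x 0 * 2 ^ (n₂ * (δ / 4)) := by gcongr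
              _ ≤ N 0 := hNx 0
          exact_mod_cast this)
      Cin Cout
      (fun i => by
        rw [← hn₁]
        have := hR0 i
        simp only [Pi.zero_apply] at this
        nlinarith [(hbounds i).2, hin i])
      (by rw [← hn₁, Real.logb_le_iff_le_rpow one_lt_two (by positivity)]
          nlinarith)
    subst hn₁
    refine ⟨_, c, fun i => Nat.mul_pos (hM i) (hL1 i), hc, fun i => ?_, hce⟩
    have hMi : (M i : ℝ) ≠ 0 := by exact_mod_cast Nat.one_le_iff_ne_zero.1 (hM i)
    have hLi : (L i : ℝ) ≠ 0 := by exact_mod_cast Nat.one_le_iff_ne_zero.1 (hL1 i)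
    rw [one_div, inv_mul_eq_div, le_div_iff₀' hn', Nat.cast_mul, Real.logb_mul hMi hLi]
    have h1 := (hbounds i).1
    have h2 := hMr i
    have h3 := hrate i
    have hRi := hR0 i
    have hSi := hS0 i
    simp only [Pi.zero_apply] at hRi hSi
    -- Rounding `β * n` down helps the first part and costs the second at most `R i` bits, which is
    -- at most `n * (δ / 2)`. The rate losses of the two codes use the other `n * (δ / 2)`.
    have h4 : ((n₁ + n₂ : ℕ) : ℝ) * ((1 - β) * S i) ≤ n₁ * S i := by
      have : ((n₁ + n₂ : ℕ) : ℝ) * (1 - β) ≤ n₁ := by linarith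
      nlinarith
    have h5 : ((n₁ + n₂ : ℕ) : ℝ) * (β * R i) ≤ n₂ * R i + R i := by nlinarith
    have h6 : (n₁ : ℝ) * (δ / 4) + n₂ * (δ / 2) ≤ ((n₁ + n₂ : ℕ) : ℝ) * (δ / 2) := by
      rw [hcast]
      nlinarith [Nat.cast_nonneg (α := ℝ) n₁]
    simp only [hx] at h1
    linarith
  exact Filter.eventually_atTop.1 hall

end MAC

/-! ### Weighted sums over closures -/

/-- A strict lower bound for a supremum over a closure is already exceeded on the set itself. -/
theorem exists_lt_of_lt_weightedSum_closure {α : ℝ} {S : Set (Fin 2 → ℝ)} {r : EReal}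
    (h : r < weightedSum α (closure S)) : ∃ R ∈ S, r < ((α * R 0 + (1 - α) * R 1 : ℝ) : EReal) := by
  obtain ⟨R, hR⟩ := lt_iSup_iff.1 h
  obtain ⟨hRS, hr⟩ := lt_iSup_iff.1 hR
  have hcont : Continuous fun R : Fin 2 → ℝ => ((α * R 0 + (1 - α) * R 1 : ℝ) : EReal) :=
    continuous_coe_real_ereal.comp (by fun_prop)
  obtain ⟨R', hr', hR'⟩ := mem_closure_iff.1 hRS _ (isOpen_lt continuous_const hcont) hr
  exact ⟨R', hR', hr'⟩

theorem le_weightedSum {α : ℝ} {S : Set (Fin 2 → ℝ)} {R : Fin 2 → ℝ} (h : R ∈ S) :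
    ((α * R 0 + (1 - α) * R 1 : ℝ) : EReal) ≤ weightedSum α S :=
  le_iSup₂ (f := fun (R : Fin 2 → ℝ) (_ : R ∈ S) => ((α * R 0 + (1 - α) * R 1 : ℝ) : EReal)) R h

theorem weightedSum_mono {α : ℝ} {S T : Set (Fin 2 → ℝ)} (h : S ⊆ T) :
    weightedSum α S ≤ weightedSum α T :=
  biSup_mono h

/-- As `exists_lt_of_lt_weightedSum_closure`, for a union over `J ≥ 1` of closures. -/
theorem exists_lt_of_lt_weightedSum_closure_iUnion {α : ℝ} {S : ℕ → Set (Fin 2 → ℝ)} {r : EReal}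
    (h : r < weightedSum α (closure (⋃ J : ℕ, ⋃ _ : 1 ≤ J, closure (S J)))) :
    ∃ J, ∃ R ∈ S J, r < ((α * R 0 + (1 - α) * R 1 : ℝ) : EReal) := by
  obtain ⟨R, hR, hr⟩ := exists_lt_of_lt_weightedSum_closure h
  obtain ⟨J, hJ⟩ := Set.mem_iUnion.1 hR
  obtain ⟨_, hRJ⟩ := Set.mem_iUnion.1 hJ
  exact ⟨J, exists_lt_of_lt_weightedSum_closure (hr.trans_le (le_weightedSum hRJ))⟩

/-! ### The jump at zero output rate -/

namespace MAC

variable {X : Fin 2 → Type u} {Y : Type v} [MeasurableSpace Y] {J : ℕ}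

/-- Without output from the facilitator, its input is useless. -/
theorem MaxAchievable.of_output_zero {W : MAC X Y} {Cin : Fin 2 → ℝ≥0} {R : Fin 2 → ℝ}
    (h : W.MaxAchievable Cin 0 J R) (Cin' : Fin 2 → ℝ≥0) : W.MaxAchievable Cin' 0 J R := by
  intro ε hε δ hδ
  obtain ⟨N, hN⟩ := h ε hε δ hδ
  refine ⟨N, fun n hn => ?_⟩
  obtain ⟨M, c, hM, hc, hR, hmax⟩ := hN n hn
  obtain ⟨b, hb⟩ := c.exists_blockCode hM hc W
  refine ⟨M, b.toCFCode J, hM, b.toCFCode_respects J _ _, hR, le_of_eq_of_le ?_ hmax⟩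
  exact iSup_congr fun m => (b.errorProb_toCFCode J W m).trans (hb m)

/-- Identifies the value at the point of discontinuity with the one without cooperation, to which
the hypothesis on the channel refers. -/
theorem maxSumCapacity_output_zero_le (W : MAC X Y) (α : ℝ) (Cin Cin' : Fin 2 → ℝ≥0) :
    W.maxSumCapacity α Cin 0 ≤ W.maxSumCapacity α Cin' 0 :=
  weightedSum_mono <| closure_mono <| Set.iUnion_mono fun _ => Set.iUnion_mono fun _ =>
    closure_mono fun _ hR => ⟨hR.1, hR.2.of_output_zero Cin'⟩

theorem le_maxSumCapacity {W : MAC X Y} {Cin Cout : Fin 2 → ℝ≥0} {R : Fin 2 → ℝ} (α : ℝ)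
    (hJ : 1 ≤ J) (hR0 : 0 ≤ R) (hR : W.MaxAchievable Cin Cout J R) :
    ((α * R 0 + (1 - α) * R 1 : ℝ) : EReal) ≤ W.maxSumCapacity α Cin Cout :=
  le_weightedSum <| subset_closure <| Set.mem_iUnion₂.2 ⟨J, hJ, subset_closure ⟨hR0, hR⟩⟩

/-- Any channel with a code has one with a single message pair. -/
theorem maxAchievable_zero_of_avgAchievable {W : MAC X Y} {J' : ℕ} {R : Fin 2 → ℝ}
    (h : W.AvgAchievable 0 0 J' R) (Cin Cout : Fin 2 → ℝ≥0) (J : ℕ) :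
    W.MaxAchievable Cin Cout J 0 := by
  obtain ⟨n, ⟨M, b, hM, -, -⟩, hn⟩ := ((exists_blockCode_of_avgError W h one_pos one_pos).and
    (Filter.eventually_gt_atTop 0)).exists
  intro ε hε δ hδ
  -- One input symbol per encoder, taken from the given code, is repeated; with a single message
  -- pair the error event is empty.
  refine ⟨0, fun n' _ => ⟨fun _ => 1, BlockCode.toCFCode
    ⟨fun i _ _ => b.f i ⟨0, hM i⟩ ⟨0, hn⟩, fun _ _ => 0, measurable_const⟩ J, fun _ => le_rfl,
    BlockCode.toCFCode_respects _ _ _ _, fun i => ?_, ciSup_le fun m => ?_⟩⟩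
  · simpa using hδ.le
  · refine le_of_eq_of_le ?_ hε.le
    rw [BlockCode.errorProb_toCFCode, BlockCode.errorProb, Subsingleton.elim m fun _ => 0]
    simp [outputProb]

/-- If maximal and average error differ without cooperation, then an arbitrarily small positive
output rate of the facilitator raises the maximal-error capacity by a fixed amount. -/
theorem exists_lt_le_maxSumCapacity (W : MAC X Y) {α : ℝ} (Cin : Fin 2 → ℝ≥0)
    (hCin : ∀ i, 0 < Cin i) (h : W.maxSumCapacity α 0 0 < W.avgSumCapacity α 0 0) :
    ∃ r : ℝ, W.maxSumCapacity α 0 0 < r ∧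
      ∀ Cout : Fin 2 → ℝ≥0, 0 < Cout 0 → (r : EReal) ≤ W.maxSumCapacity α Cin Cout := by
  obtain ⟨J', R, ⟨hR0, hR⟩, hlt⟩ := exists_lt_of_lt_weightedSum_closure_iUnion h
  -- The region contains the zero pair, so its value is not the supremum over the empty set; with
  -- the strict upper bound it is a real number `μ`.
  have hbot : W.maxSumCapacity α 0 0 ≠ ⊥ := fun heq => by
    have := le_maxSumCapacity α le_rfl le_rfl (maxAchievable_zero_of_avgAchievable hR 0 0 1)
    rw [heq, le_bot_iff] at this
    exact EReal.coe_ne_bot _ this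
  obtain ⟨μ, hμ⟩ : ∃ μ : ℝ, (μ : EReal) = W.maxSumCapacity α 0 0 :=
    ⟨_, EReal.coe_toReal (ne_top_of_lt hlt) hbot⟩
  rw [← hμ, EReal.coe_lt_coe_iff] at hlt
  set A := α * R 0 + (1 - α) * R 1 with hA
  obtain ⟨β, hβR, hβ⟩ : ∃ β : ℝ, (∀ i, β * R i < Cin i) ∧ β ∈ Set.Ioo (0 : ℝ) 1 := by
    have hev : ∀ i, ∀ᶠ β : ℝ in nhdsWithin 0 (Set.Ioi 0), β * R i < Cin i := fun i =>
      nhdsWithin_le_nhds ((by fun_prop : Continuous fun β : ℝ => β * R i).continuousAt.eventually_lt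
        continuousAt_const (by simpa using hCin i))
    exact ((Filter.eventually_all.2 hev).and (Ioo_mem_nhdsGT one_pos)).exists
  -- Time sharing gains `β * (A - μ)` over `μ`. Taking `S` within half of that gain keeps the total
  -- above `μ`; neither `β` nor `S` depends on `Cout`.
  have hgap : 0 < β * (A - μ) := mul_pos hβ.1 (sub_pos.2 hlt)
  obtain ⟨J, S, ⟨hS0, hS⟩, hlt'⟩ : ∃ J, ∃ S ∈ {S | 0 ≤ S ∧ W.MaxAchievable 0 0 J S},
      ((μ - β * (A - μ) / 2 : ℝ) : EReal) < ((α * S 0 + (1 - α) * S 1 : ℝ) : EReal) := by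
    refine exists_lt_of_lt_weightedSum_closure_iUnion (lt_of_lt_of_eq ?_ hμ)
    exact EReal.coe_lt_coe_iff.2 (by linarith)
  rw [EReal.coe_lt_coe_iff] at hlt'
  refine ⟨α * ((1 - β) * S 0 + β * R 0) + (1 - α) * ((1 - β) * S 1 + β * R 1), ?_,
    fun Cout hCout => le_maxSumCapacity α le_rfl (fun i => ?_)
      (maxAchievable_timeShare W hS0 hR0 hS hR hβ Cin Cout hβR hCout)⟩
  · rw [← hμ, EReal.coe_lt_coe_iff]
    have h1 := mul_lt_mul_of_pos_left hlt' (sub_pos.2 hβ.2)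
    have h2 := mul_pos hβ.1 hgap
    have h3 : α * ((1 - β) * S 0 + β * R 0) + (1 - α) * ((1 - β) * S 1 + β * R 1) =
        (1 - β) * (α * S 0 + (1 - α) * S 1) + β * A := by rw [hA]; ring
    rw [h3]
    linarith
  · exact add_nonneg (mul_nonneg (sub_pos.2 hβ.2).le (hS0 i)) (mul_nonneg hβ.1.le (hR0 i))

end MAC

theorem proposition4 {X : Fin 2 → Type u} {Y : Type v} [MeasurableSpace Y] (W : MAC X Y)
    (α : ℝ) (hα : α ∈ Set.Ioo (0 : ℝ) 1) (Cin : Fin 2 → ℝ≥0) (hCin : ∀ i, 0 < Cin i)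
    (h : W.maxSumCapacity α 0 0 < W.avgSumCapacity α 0 0) :
    ¬ ContinuousAt (fun Cout : Fin 2 → ℝ≥0 => W.maxSumCapacity α Cin Cout) 0 := by
  intro hcont
  obtain ⟨r, hr, hle⟩ := W.exists_lt_le_maxSumCapacity Cin hCin h
  have hzero : W.maxSumCapacity α Cin 0 < r :=
    (W.maxSumCapacity_output_zero_le α Cin 0).trans_lt hr
  have hev : ∀ᶠ Cout : Fin 2 → ℝ≥0 in nhds 0, W.maxSumCapacity α Cin Cout < r :=
    hcont.eventually_lt continuousAt_const hzero
  -- Zero is approached along the diagonal through positive rates, where the value stays at least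
  -- `r`.
  have hconst : Filter.Tendsto (fun (t : ℝ≥0) (_ : Fin 2) => t) (nhdsWithin 0 (Set.Ioi 0))
      (nhds 0) :=
    tendsto_nhdsWithin_of_tendsto_nhds
      ((by fun_prop : Continuous fun (t : ℝ≥0) (_ : Fin 2) => t).tendsto' 0 0 rfl)
  obtain ⟨t, ht, ht0⟩ := ((hconst.eventually hev).and self_mem_nhdsWithin).exists
  exact (hle _ ht0).not_gt ht
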